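/- Let $\mathfrak U_2(\mathbb R)$ be the set of Borel probability measures on $\mathbb R$ with finite second moment, with the Wasserstein metric $\ell_2(\mu,\nu)=\bigl(\inf_{\gamma\in\Gamma(\mu,\nu)}\int|x-y|^2\,d\gamma(x,y)\bigr)^{1/2}$, where $\Gamma(\mu,\nu)$ is the set of probability measures on $\mathbb R^2$ with marginals $\mu$ and $\nu$. For $\mu\in\mathfrak U_2(\mathbb R)$ and $x\in(0,1)$ let $F_\mu^+(x)=\inf\{y\in\mathbb R:\mu((-\infty,y])\ge x\}$ be its inverse cumulative distribution function. Let $\mathcal G$ be a connected undirected graph on a finite vertex set $\mathcal V$, and let $W=[w_{ij}]$ be a real $\mathcal V\times\mathcal V$ matrix such that $w_{ij}>0$ if $i=j$ or $\{i,j\}$ is an edge of $\mathcal G$, $w_{ij}=0$ otherwise, and $\sum_j w_{ij}=1$ for every $i$. Let $\lambda$ be the second largest eigenvalue modulus of $W$, that is, the largest modulus among the complex eigenvalues of $W$, counted with algebraic multiplicity, that remain after one copy of the eigenvalue $1$ is removed ($\lambda=0$ if none remains). Then: 1. For all $(m_j)_{j\in\mathcal V}$ in $\mathfrak U_2(\mathbb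 R)$ and every $i\in\mathcal V$, the functional $\eta\mapsto\sum_j w_{ij}\,\ell_2(\eta,m_j)^2$ has exactly one minimiser over $\mathfrak U_2(\mathbb R)$. 2. $\lambda<1$. 3. Let $\mu_i(t)\in\mathfrak U_2(\mathbb R)$ ($i\in\mathcal V$, $t\in\mathbb N$, with arbitrary $\mu_i(0)$) satisfy the update rule $$\mu_i(t+1)=\operatorname*{argmin}_{\eta\in\mathfrak U_2(\mathbb R)}\ \sum_j w_{ij}\,\ell_2(\eta,\mu_j(t))^2 .$$ Then $F^+_{\mu_i(t+1)}(x)=\sum_j w_{ij}F^+_{\mu_j(t)}(x)$ for all $i$, $t$ and all $x\in(0,1)$. Moreover there is $\mu^*\in\mathfrak U_2(\mathbb R)$ such that $\lim_{t\to\infty}\ell_2(\mu_i(t),\mu^*)=0$ for every $i$, at an exponential rate governed by $\lambda$: for every $\rho>\lambda$ there is a constant $C$ with $\ell_2(\mu_i(t),\mu^*)\le C\rho^t$ for all $i$ and $t$; and if $W$ is diagonalisable over $\mathbb C$, there is a constant $C$ with $\ell_2(\mu_i(t),\mu^*)\le C\lambda^t$ for all $i$ and $t$ (with $0^0=1$).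 -/

import Mathlib

open MeasureTheory ProbabilityTheory Filter Topology
open scoped NNReal ENNReal

noncomputable section

/-- `𝔘₂(ℝ)`: the Borel probability measures on `ℝ` with finite second moment. -/
abbrev U2 : Type :=
  {μ : ProbabilityMeasure ℝ // MemLp (fun x : ℝ => x) 2 (μ : Measure ℝ)}

/-- The underlying Borel measure of an element of `𝔘₂(ℝ)`. -/
def U2.meas (μ : U2) : Measure ℝ := (μ.1 : Measure ℝ)

/-- `Γ(μ, ν)`: the measures on `ℝ × ℝ` with first marginal `μ` and second marginal `ν`
(they are automatically probability measures). -/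
def couplings (μ ν : U2) : Set (Measure (ℝ × ℝ)) :=
  {γ | γ.fst = μ.meas ∧ γ.snd = ν.meas}

/-- The Wasserstein metric `ℓ₂` on `𝔘₂(ℝ)`. The infimum is taken in `[0, ∞]`; on `𝔘₂(ℝ)` it is
finite, since the product coupling has finite cost. -/
def ell2 (μ ν : U2) : ℝ :=
  Real.sqrt (⨅ γ ∈ couplings μ ν, ∫⁻ z, edist z.1 z.2 ^ 2 ∂γ).toReal

/-- The inverse cumulative distribution function
`F⁺(x) = inf {y : F(y) ≥ x}`, where `F(y) = μ((-∞, y])`; meaningful for `0 < x < 1`. -/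
def invCdf (μ : U2) (x : ℝ) : ℝ := sInf {y : ℝ | x ≤ μ.meas.real (Set.Iic y)}

variable {V : Type*} [Fintype V]

/-- `W` is a weighted adjacency matrix of the undirected graph `G`, in which every vertex is
understood to carry a self-loop: positive weights exactly on the edges and loops, zero weights
elsewhere, and rows that sum to one. -/
structure IsWeightMatrix (G : SimpleGraph V) (W : Matrix V V ℝ) : Prop where
  pos_iff : ∀ i j, 0 < W i j ↔ i = j ∨ G.Adj i j
  eq_zero : ∀ i j, ¬ (i = j ∨ G.Adj i j) → W i j = 0
  row_sum : ∀ i, ∑ j, W i j = 1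

/-- `η` minimises `∑ j, w j * ℓ₂(η, m j)²` over `𝔘₂(ℝ)`. -/
def IsBarycentre (w : V → ℝ) (m : V → U2) (η : U2) : Prop :=
  ∀ ξ : U2, ∑ j, w j * ell2 η (m j) ^ 2 ≤ ∑ j, w j * ell2 ξ (m j) ^ 2

/-- `μ t i` is the state of agent `i` at time `t`, and every agent updates its state to the
weighted barycentre of the states of its neighbours. -/
def IsTrajectory (W : Matrix V V ℝ) (μ : ℕ → V → U2) : Prop :=
  ∀ t i, IsBarycentre (W i) (μ t) (μ (t + 1) i)

/-- The real matrix `W` is diagonalisable over `ℂ`. -/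
def IsDiagonalisable [DecidableEq V] (W : Matrix V V ℝ) : Prop :=
  ∃ (P : Matrix V V ℂ) (d : V → ℂ), IsUnit P.det ∧
    W.map Complex.ofReal * P = P * Matrix.diagonal d

/-- The second largest eigenvalue modulus of a stochastic matrix `W`: the largest modulus among
the complex eigenvalues of `W`, listed with algebraic multiplicity, after one copy of the
eigenvalue `1` (the largest one) has been removed; `0` if no eigenvalue is left. -/
def slem [DecidableEq V] (W : Matrix V V ℝ) : ℝ :=
  (((W.map Complex.ofReal).charpoly.roots.erase 1).map (fun z => ‖z‖₊)).sup

end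

/-!
On the line, the quadratic optimal transport problem is solved by the quantile coupling: by
Hoeffding's formula (`lintegral_edist_sq`) the cost of a plan is an integral of masses of quadrants
`(-∞, a] × (b, ∞)`, and the quantile coupling minimises all of these simultaneously
(`quantileCoupling_quadrant_le`). Hence `μ ↦ F⁺_μ` embeds `𝔘₂(ℝ)` isometrically into the Hilbert
space `L²(0, 1)` (`ell2_eq_norm_quantile_sub`). The image consists of the monotone left-continuous
square-integrable functions (`exists_invCdf_eq`), so it is closed under nonnegative combinations, and the
barycentre in `𝔘₂(ℝ)` is the one in Hilbert space: the weighted mean of the quantile functions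
(`isBarycentre_iff`).

A trajectory is therefore `F⁺(t) = W ^ t F⁺(0)`, and its behaviour is that of the powers of the
stochastic matrix `W`. By Gershgorin's theorem (`IsWeightMatrix.norm_lt_one_or_eq_one`), `1` is the
only eigenvalue of modulus at least one, the diagonal of `W` being positive. By the maximum
principle on the connected graph, `W v = v + c` with a constant `c` forces `c = 0` and `v` constant,
so `1` is algebraically simple (`IsWeightMatrix.count_roots_charpoly_one_le`); thus `slem W < 1`.
Removing the eigenvalue `1` by subtracting the spectral projection `L`, Gelfand's formula for `W - L`
gives `W ^ t - L = O(ρ ^ t)` for every `ρ > slem W`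
(`IsWeightMatrix.exists_pow_apply_sub_isBigO`). When `W` is diagonalisable, an eigenbasis gives
`O(slem W ^ t)` (`IsWeightMatrix.exists_abs_pow_apply_sub_le`). The rows of `L` are a probability
vector `p`, and the consensus measure has quantile function `∑ j, p j * F⁺_{μ_j(0)}`.
-/

/-! ### Quantile functions -/

noncomputable section

open Set

instance U2.isProbabilityMeasure_meas (μ : U2) : IsProbabilityMeasure μ.meas :=
  inferInstanceAs (IsProbabilityMeasure (μ.1 : Measure ℝ))

theorem U2.ext_meas {μ ν : U2} (h : μ.meas = ν.meas) : μ = ν :=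
  Subtype.ext (Subtype.ext h)

/-- The uniform distribution on `(0, 1)`, the common domain of all quantile functions. -/
def unitLeb : Measure ℝ := volume.restrict (Ioo 0 1)

instance : IsProbabilityMeasure unitLeb := ⟨by simp [unitLeb]⟩

theorem unitLeb_Iic_inter_Ioi {a b : ℝ} (ha : a ≤ 1) (hb : 0 ≤ b) :
    unitLeb (Iic a ∩ Ioi b) = ENNReal.ofReal (a - b) := by
  rw [unitLeb, Measure.restrict_apply (measurableSet_Iic.inter measurableSet_Ioi)]
  apply le_antisymm
  · rw [← Real.volume_Ioc]
    exact measure_mono fun x hx => ⟨hx.1.2, hx.1.1⟩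
  · rw [← Real.volume_Ioo]
    exact measure_mono fun x hx =>
      ⟨⟨hx.2.le, hx.1⟩, hb.trans_lt hx.1, hx.2.trans_le ha⟩

theorem unitLeb_Iic {a : ℝ} (ha : a ≤ 1) : unitLeb (Iic a) = ENNReal.ofReal a := by
  have h := unitLeb_Iic_inter_Ioi ha le_rfl
  rw [sub_zero] at h
  rw [← h, unitLeb, Measure.restrict_apply measurableSet_Iic,
    Measure.restrict_apply (measurableSet_Iic.inter measurableSet_Ioi)]
  congr 1
  ext x
  simp only [mem_inter_iff, mem_Iic, mem_Ioo, mem_Ioi]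
  tauto

theorem ae_mem_Ioo_unitLeb : ∀ᵐ x ∂unitLeb, x ∈ Ioo (0 : ℝ) 1 :=
  ae_restrict_mem measurableSet_Ioo

/-- The Galois connection between the inverse cumulative distribution function and the
cumulative distribution function. -/
theorem invCdf_le_iff (μ : U2) {x : ℝ} (hx : x ∈ Ioo (0 : ℝ) 1) (y : ℝ) :
    invCdf μ x ≤ y ↔ x ≤ μ.meas.real (Iic y) := by
  simp only [invCdf, ← cdf_eq_real]
  set S := {z : ℝ | x ≤ cdf μ.meas z} with hS
  have hne : S.Nonempty := by
    obtain ⟨z, hz⟩ := ((tendsto_cdf_atTop μ.meas).eventually (lt_mem_nhds hx.2)).exists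
    exact ⟨z, hz.le⟩
  have hbdd : BddBelow S := by
    obtain ⟨z, hz⟩ := ((tendsto_cdf_atBot μ.meas).eventually (gt_mem_nhds hx.1)).exists
    refine ⟨z, fun w hw => le_of_not_gt fun hwz => ?_⟩
    exact absurd (hw.trans (monotone_cdf μ.meas hwz.le)) (not_le.2 hz)
  have hmem : x ≤ cdf μ.meas (sInf S) := by
    refine ge_of_tendsto
      (((cdf μ.meas).right_continuous (sInf S)).mono_left (nhdsWithin_mono _ Ioi_subset_Ici_self)) ?_
    filter_upwards [self_mem_nhdsWithin] with z hz
    obtain ⟨w, hw, hwz⟩ := exists_lt_of_csInf_lt hne hz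
    exact hw.trans (monotone_cdf μ.meas hwz.le)
  exact ⟨fun h => hmem.trans (monotone_cdf μ.meas h), fun h => csInf_le hbdd h⟩

theorem lt_invCdf_iff (μ : U2) {x : ℝ} (hx : x ∈ Ioo (0 : ℝ) 1) (y : ℝ) :
    y < invCdf μ x ↔ μ.meas.real (Iic y) < x := by
  rw [← not_le, invCdf_le_iff μ hx, not_le]

theorem monotoneOn_invCdf (μ : U2) : MonotoneOn (invCdf μ) (Ioo 0 1) := by
  intro x hx y hy hxy
  rw [invCdf_le_iff μ hx]
  exact hxy.trans ((invCdf_le_iff μ hy _).1 le_rfl)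

theorem continuousWithinAt_invCdf (μ : U2) {x : ℝ} (hx : x ∈ Ioo (0 : ℝ) 1) :
    ContinuousWithinAt (invCdf μ) (Iic x) x := by
  have hpos : ∀ᶠ u in 𝓝[≤] x, 0 < u := eventually_nhdsWithin_of_eventually_nhds (lt_mem_nhds hx.1)
  refine tendsto_order.2 ⟨fun a ha => ?_, fun a ha => ?_⟩
  · rw [lt_invCdf_iff μ hx] at ha
    filter_upwards [hpos, self_mem_nhdsWithin,
      eventually_nhdsWithin_of_eventually_nhds (lt_mem_nhds ha)] with u h0 hu hau
    exact (lt_invCdf_iff μ ⟨h0, lt_of_le_of_lt hu hx.2⟩ a).2 hau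
  · filter_upwards [hpos, self_mem_nhdsWithin] with u h0 hu
    exact (monotoneOn_invCdf μ ⟨h0, lt_of_le_of_lt hu hx.2⟩ hx hu).trans_lt ha

theorem aemeasurable_invCdf (μ : U2) : AEMeasurable (invCdf μ) unitLeb :=
  aemeasurable_restrict_of_monotoneOn measurableSet_Ioo (monotoneOn_invCdf μ)

theorem invCdf_preimage_Iic_ae_eq (μ : U2) (y : ℝ) :
    invCdf μ ⁻¹' Iic y =ᵐ[unitLeb] Iic (μ.meas.real (Iic y)) := by
  filter_upwards [ae_mem_Ioo_unitLeb] with x hx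
  exact propext (invCdf_le_iff μ hx y)

theorem invCdf_preimage_Ioi_ae_eq (μ : U2) (y : ℝ) :
    invCdf μ ⁻¹' Ioi y =ᵐ[unitLeb] Ioi (μ.meas.real (Iic y)) := by
  filter_upwards [ae_mem_Ioo_unitLeb] with x hx
  exact propext (lt_invCdf_iff μ hx y)

/-- Inverse transform sampling: the inverse cumulative distribution function pushes the uniform
distribution forward to the measure itself. -/
theorem map_invCdf (μ : U2) : unitLeb.map (invCdf μ) = μ.meas := by
  have := Measure.isProbabilityMeasure_map (aemeasurable_invCdf μ)
  refine Measure.ext_of_Iic _ _ fun y => ?_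
  rw [Measure.map_apply_of_aemeasurable (aemeasurable_invCdf μ) measurableSet_Iic,
    measure_congr (invCdf_preimage_Iic_ae_eq μ y), unitLeb_Iic measureReal_le_one,
    ofReal_measureReal]

theorem memLp_invCdf (μ : U2) : MemLp (invCdf μ) 2 unitLeb := by
  have h : MemLp (fun x : ℝ => x) 2 (unitLeb.map (invCdf μ)) := by
    rw [map_invCdf]; exact μ.2
  exact (memLp_map_measure_iff h.1 (aemeasurable_invCdf μ)).1 h

/-- Every monotone, left-continuous, square-integrable function on `(0, 1)` is the inverse
cumulative distribution function of a measure with finite second moment. -/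
theorem exists_invCdf_eq {B : ℝ → ℝ} (hmono : MonotoneOn B (Ioo 0 1))
    (hcont : ∀ x ∈ Ioo (0 : ℝ) 1, ContinuousWithinAt B (Iic x) x) (hB : MemLp B 2 unitLeb) :
    ∃ η : U2, ∀ x ∈ Ioo (0 : ℝ) 1, invCdf η x = B x := by
  have hm : AEMeasurable B unitLeb := aemeasurable_restrict_of_monotoneOn measurableSet_Ioo hmono
  let η : U2 := ⟨⟨unitLeb.map B, Measure.isProbabilityMeasure_map hm⟩,
    (memLp_map_measure_iff aestronglyMeasurable_id hm).2 hB⟩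
  refine ⟨η, fun x hx => eq_of_forall_ge_iff fun y => ?_⟩
  have hη : η.meas (Iic y) = unitLeb (B ⁻¹' Iic y) :=
    Measure.map_apply_of_aemeasurable hm measurableSet_Iic
  rw [invCdf_le_iff η hx, Measure.real, hη]
  constructor
  · intro h
    by_contra! hy
    -- by left-continuity `B` already exceeds `y` on `(z, 1)` for some `z < x`
    obtain ⟨z, hz, hzx⟩ := (mem_nhdsLE_iff_exists_Ioc_subset' hx.1).1 ((hcont x hx).eventually
      (lt_mem_nhds hy))
    set w := max z 0
    have hw : w < x := max_lt hz hx.1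
    have hle : unitLeb (B ⁻¹' Iic y) ≤ unitLeb (Iic w) := by
      apply measure_mono_ae
      filter_upwards [ae_mem_Ioo_unitLeb] with u hu huy
      refine le_of_not_gt fun hwu => not_lt.2 (show B u ≤ y from huy) ?_
      rcases le_total u x with hux | hux
      · exact hzx ⟨(le_max_left _ _).trans_lt hwu, hux⟩
      · exact hy.trans_le (hmono hx hu hux)
    rw [unitLeb_Iic (hw.trans hx.2).le] at hle
    have := ENNReal.toReal_mono ENNReal.ofReal_ne_top hle
    rw [ENNReal.toReal_ofReal (le_max_right _ _)] at this
    linarith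
  · intro h
    have hle : unitLeb (Iic x) ≤ unitLeb (B ⁻¹' Iic y) := by
      apply measure_mono_ae
      filter_upwards [ae_mem_Ioo_unitLeb] with u hu hux
      exact (hmono hu hx hux).trans h
    rw [unitLeb_Iic hx.2.le] at hle
    have := ENNReal.toReal_mono (measure_ne_top _ _) hle
    rwa [ENNReal.toReal_ofReal hx.1.le] at this

/-! ### Optimal transport on the line -/

/-- The squared distance of `x` and `y` is the sum of the areas of `[x, y)²` and `[y, x)²`, one of
which is empty. -/
theorem edist_sq_eq_volume (z : ℝ × ℝ) :
    edist z.1 z.2 ^ 2 = volume {p : ℝ × ℝ | z.1 ≤ min p.1 p.2 ∧ max p.1 p.2 < z.2} +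
      volume {p : ℝ × ℝ | z.2 ≤ min p.1 p.2 ∧ max p.1 p.2 < z.1} := by
  have key : ∀ x y : ℝ, volume {p : ℝ × ℝ | x ≤ min p.1 p.2 ∧ max p.1 p.2 < y} =
      ENNReal.ofReal (y - x) ^ 2 := by
    intro x y
    have : {p : ℝ × ℝ | x ≤ min p.1 p.2 ∧ max p.1 p.2 < y} = Ico x y ×ˢ Ico x y := by
      ext p
      simp only [mem_ofPred_eq, mem_prod, mem_Ico, le_min_iff, max_lt_iff]
      tauto
    rw [this, Measure.volume_eq_prod, Measure.prod_prod, Real.volume_Ico, sq]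
  rw [key, key, edist_dist, Real.dist_eq]
  rcases le_total z.1 z.2 with h | h
  · rw [abs_sub_comm, abs_of_nonneg (sub_nonneg.2 h), ENNReal.ofReal_of_nonpos (sub_nonpos.2 h)]
    simp
  · rw [abs_of_nonneg (sub_nonneg.2 h), ENNReal.ofReal_of_nonpos (sub_nonpos.2 h)]
    simp

/-- Hoeffding's formula: the quadratic cost of a plan depends on it only through the masses of
quadrants. -/
theorem lintegral_edist_sq (γ : Measure (ℝ × ℝ)) [SFinite γ] :
    ∫⁻ z, edist z.1 z.2 ^ 2 ∂γ =
      ∫⁻ p : ℝ × ℝ, (γ {z | z.1 ≤ min p.1 p.2 ∧ max p.1 p.2 < z.2} +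
        γ {z | z.2 ≤ min p.1 p.2 ∧ max p.1 p.2 < z.1}) := by
  have key : ∀ f g : ℝ × ℝ → ℝ, Measurable f → Measurable g →
      Measurable (fun z => volume {p : ℝ × ℝ | f z ≤ min p.1 p.2 ∧ max p.1 p.2 < g z}) ∧
      Measurable (fun p : ℝ × ℝ => γ {z : ℝ × ℝ | f z ≤ min p.1 p.2 ∧ max p.1 p.2 < g z}) ∧
      ∫⁻ z, volume {p : ℝ × ℝ | f z ≤ min p.1 p.2 ∧ max p.1 p.2 < g z} ∂γ =
        ∫⁻ p : ℝ × ℝ, γ {z : ℝ × ℝ | f z ≤ min p.1 p.2 ∧ max p.1 p.2 < g z} := by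
    intro f g hf hg
    have hA : MeasurableSet {q : (ℝ × ℝ) × ℝ × ℝ |
        f q.1 ≤ min q.2.1 q.2.2 ∧ max q.2.1 q.2.2 < g q.1} := by
      have hle : MeasurableSet {q : (ℝ × ℝ) × ℝ × ℝ | f q.1 ≤ min q.2.1 q.2.2} :=
        measurableSet_le (by fun_prop) (by fun_prop)
      have hlt : MeasurableSet {q : (ℝ × ℝ) × ℝ × ℝ | max q.2.1 q.2.2 < g q.1} :=
        measurableSet_lt (by fun_prop) (by fun_prop)
      exact hle.inter hlt
    exact ⟨measurable_measure_prodMk_left hA, measurable_measure_prodMk_right hA,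
      (Measure.prod_apply (μ := γ) (ν := volume) hA).symm.trans (Measure.prod_apply_symm hA)⟩
  obtain ⟨h1, h2, h3⟩ := key Prod.fst Prod.snd measurable_fst measurable_snd
  obtain ⟨-, -, h3'⟩ := key Prod.snd Prod.fst measurable_snd measurable_fst
  simp_rw [edist_sq_eq_volume]
  rw [lintegral_add_left h1, lintegral_add_left h2, h3, h3']

theorem isProbabilityMeasure_of_mem_couplings {μ ν : U2} {γ : Measure (ℝ × ℝ)}
    (hγ : γ ∈ couplings μ ν) : IsProbabilityMeasure γ := by
  refine ⟨?_⟩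
  rw [← Measure.fst_univ, hγ.1, measure_univ]

/-- The quantile coupling, under which both coordinates are driven by one uniform variable. -/
def quantileCoupling (μ ν : U2) : Measure (ℝ × ℝ) :=
  unitLeb.map fun u => (invCdf μ u, invCdf ν u)

theorem aemeasurable_invCdf_prodMk (μ ν : U2) :
    AEMeasurable (fun u => (invCdf μ u, invCdf ν u)) unitLeb :=
  (aemeasurable_invCdf μ).prodMk (aemeasurable_invCdf ν)

theorem quantileCoupling_mem_couplings (μ ν : U2) : quantileCoupling μ ν ∈ couplings μ ν := by
  constructor
  · rw [quantileCoupling, Measure.fst, AEMeasurable.map_map_of_aemeasurable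
      measurable_fst.aemeasurable (aemeasurable_invCdf_prodMk μ ν)]
    exact map_invCdf μ
  · rw [quantileCoupling, Measure.snd, AEMeasurable.map_map_of_aemeasurable
      measurable_snd.aemeasurable (aemeasurable_invCdf_prodMk μ ν)]
    exact map_invCdf ν

theorem measurableSet_quadrant (a b : ℝ) : MeasurableSet {z : ℝ × ℝ | z.1 ≤ a ∧ b < z.2} :=
  (measurableSet_le measurable_fst measurable_const).inter
    (measurableSet_lt measurable_const measurable_snd)

theorem measurableSet_quadrant' (a b : ℝ) : MeasurableSet {z : ℝ × ℝ | z.2 ≤ a ∧ b < z.1} :=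
  (measurableSet_le measurable_snd measurable_const).inter
    (measurableSet_lt measurable_const measurable_fst)

theorem unitLeb_invCdf_quadrant (μ ν : U2) (a b : ℝ) :
    unitLeb (invCdf μ ⁻¹' Iic a ∩ invCdf ν ⁻¹' Ioi b) = μ.meas (Iic a) - ν.meas (Iic b) := by
  rw [measure_congr ((invCdf_preimage_Iic_ae_eq μ a).inter (invCdf_preimage_Ioi_ae_eq ν b)),
    unitLeb_Iic_inter_Ioi measureReal_le_one measureReal_nonneg,
    ENNReal.ofReal_sub _ measureReal_nonneg, ofReal_measureReal, ofReal_measureReal]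

/-- Among all couplings, the quantile coupling gives the least mass to every quadrant
`(-∞, a] × (b, ∞)`. -/
theorem quantileCoupling_quadrant_le {μ ν : U2} {γ : Measure (ℝ × ℝ)} (hγ : γ ∈ couplings μ ν)
    (a b : ℝ) :
    quantileCoupling μ ν {z | z.1 ≤ a ∧ b < z.2} ≤ γ {z | z.1 ≤ a ∧ b < z.2} := by
  rw [quantileCoupling, Measure.map_apply_of_aemeasurable (aemeasurable_invCdf_prodMk μ ν)
    (measurableSet_quadrant a b)]
  refine (unitLeb_invCdf_quadrant μ ν a b).trans_le (tsub_le_iff_right.2 ?_)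
  rw [← hγ.1, ← hγ.2, Measure.fst_apply measurableSet_Iic, Measure.snd_apply measurableSet_Iic]
  refine (measure_mono fun z hz => ?_).trans (measure_union_le _ _)
  rcases lt_or_ge b z.2 with h | h
  · exact Or.inl ⟨hz, h⟩
  · exact Or.inr h

theorem quantileCoupling_quadrant_le' {μ ν : U2} {γ : Measure (ℝ × ℝ)}
    (hγ : γ ∈ couplings μ ν) (a b : ℝ) :
    quantileCoupling μ ν {z | z.2 ≤ a ∧ b < z.1} ≤ γ {z | z.2 ≤ a ∧ b < z.1} := by
  rw [quantileCoupling, Measure.map_apply_of_aemeasurable (aemeasurable_invCdf_prodMk μ ν)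
    (measurableSet_quadrant' a b)]
  refine (unitLeb_invCdf_quadrant ν μ a b).trans_le (tsub_le_iff_right.2 ?_)
  rw [← hγ.1, ← hγ.2, Measure.fst_apply measurableSet_Iic, Measure.snd_apply measurableSet_Iic]
  refine (measure_mono fun z hz => ?_).trans (measure_union_le _ _)
  rcases lt_or_ge b z.1 with h | h
  · exact Or.inl ⟨hz, h⟩
  · exact Or.inr h

/-- The quantile coupling is an optimal transport plan for the quadratic cost on the line. -/
theorem iInf_couplings_eq (μ ν : U2) :
    ⨅ γ ∈ couplings μ ν, ∫⁻ z, edist z.1 z.2 ^ 2 ∂γ =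
      ∫⁻ u, edist (invCdf μ u) (invCdf ν u) ^ 2 ∂unitLeb := by
  have hmap : ∫⁻ u, edist (invCdf μ u) (invCdf ν u) ^ 2 ∂unitLeb =
      ∫⁻ z, edist z.1 z.2 ^ 2 ∂(quantileCoupling μ ν) :=
    (lintegral_map' (f := fun z : ℝ × ℝ => edist z.1 z.2 ^ 2) (by fun_prop)
      (aemeasurable_invCdf_prodMk μ ν)).symm
  rw [hmap]
  refine le_antisymm (iInf₂_le _ (quantileCoupling_mem_couplings μ ν)) (le_iInf₂ fun γ hγ => ?_)
  have := isProbabilityMeasure_of_mem_couplings hγ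
  have := isProbabilityMeasure_of_mem_couplings (quantileCoupling_mem_couplings μ ν)
  rw [lintegral_edist_sq, lintegral_edist_sq]
  exact lintegral_mono fun p => add_le_add (quantileCoupling_quadrant_le hγ _ _)
    (quantileCoupling_quadrant_le' hγ _ _)

/-- The inverse cumulative distribution function as a vector of the Hilbert space `L²(0, 1)`. -/
def quantile (μ : U2) : Lp ℝ 2 unitLeb := (memLp_invCdf μ).toLp

theorem coeFn_quantile (μ : U2) : quantile μ =ᵐ[unitLeb] invCdf μ := MemLp.coeFn_toLp _

/-- `𝔘₂(ℝ)` embeds isometrically into `L²(0, 1)` through quantile functions. -/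
theorem ell2_eq_norm_quantile_sub (μ ν : U2) : ell2 μ ν = ‖quantile μ - quantile ν‖ := by
  have h : ∫⁻ u, edist (invCdf μ u) (invCdf ν u) ^ 2 ∂unitLeb =
      eLpNorm (invCdf μ - invCdf ν) 2 unitLeb ^ 2 := by
    have := eLpNorm_nnreal_pow_eq_lintegral (f := invCdf μ - invCdf ν) (μ := unitLeb)
      (p := (2 : ℝ≥0)) two_ne_zero
    simp only [NNReal.coe_ofNat, ENNReal.rpow_ofNat, ENNReal.coe_ofNat] at this
    rw [this]
    simp [edist_eq_enorm_sub]
  rw [ell2, iInf_couplings_eq, h, quantile, quantile, ← MemLp.toLp_sub, Lp.norm_toLp,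
    ENNReal.toReal_pow, Real.sqrt_sq ENNReal.toReal_nonneg]

theorem quantile_injective : Function.Injective quantile := by
  intro μ ν h
  have : invCdf μ =ᵐ[unitLeb] invCdf ν :=
    (coeFn_quantile μ).symm.trans (h ▸ coeFn_quantile ν)
  apply U2.ext_meas
  rw [← map_invCdf μ, ← map_invCdf ν, Measure.map_congr this]

end

/-! ### Barycentres -/

section

open Set

/-- Inverse cumulative distribution functions are closed under nonnegative combinations. -/
theorem exists_invCdf_eq_sum {V : Type*} [Fintype V] {w : V → ℝ} (hw : ∀ j, 0 ≤ w j)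
    (m : V → U2) : ∃ η : U2, ∀ x ∈ Ioo (0 : ℝ) 1, invCdf η x = ∑ j, w j * invCdf (m j) x := by
  refine exists_invCdf_eq (B := fun x => ∑ j, w j * invCdf (m j) x) ?_ ?_ ?_
  · intro x hx y hy hxy
    exact Finset.sum_le_sum fun j _ =>
      mul_le_mul_of_nonneg_left (monotoneOn_invCdf (m j) hx hy hxy) (hw j)
  · intro x hx
    exact tendsto_finsetSum _ fun j _ => (continuousWithinAt_invCdf (m j) hx).const_mul _
  · exact memLp_finsetSum _ fun j _ => (memLp_invCdf (m j)).const_mul _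

/-- A pointwise linear relation between inverse cumulative distribution functions passes to
`L²(0, 1)`. -/
theorem quantile_eq_sum {V : Type*} [Fintype V] {w : V → ℝ} {m : V → U2} {η : U2}
    (h : ∀ x ∈ Ioo (0 : ℝ) 1, invCdf η x = ∑ j, w j * invCdf (m j) x) :
    quantile η = ∑ j, w j • quantile (m j) := by
  apply Lp.ext
  have h1 : ∀ᵐ x ∂unitLeb, ∀ j, (w j • quantile (m j) : Lp ℝ 2 unitLeb) x =
      w j * invCdf (m j) x := by
    refine ae_all_iff.2 fun j => ?_
    filter_upwards [Lp.coeFn_smul (w j) (quantile (m j)), coeFn_quantile (m j)] with x hx hx'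
    rw [hx, Pi.smul_apply, hx', smul_eq_mul]
  filter_upwards [coeFn_quantile η, h1, ae_mem_Ioo_unitLeb,
    Lp.coeFn_finsetSum Finset.univ fun j => w j • quantile (m j)] with x hη hx hx01 hs
  rw [hη, hs, h x hx01, Finset.sum_apply]
  exact Finset.sum_congr rfl fun j _ => (hx j).symm

/-- The parallel axis theorem: the weighted sum of squared distances to a family of points is
the squared distance to their weighted mean plus a constant. -/
theorem sum_mul_norm_sub_sq {V E : Type*} [Fintype V] [NormedAddCommGroup E]
    [InnerProductSpace ℝ E] {w : V → ℝ} (hw : ∑ j, w j = 1) (a : V → E) (x : E) :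
    ∑ j, w j * ‖x - a j‖ ^ 2 = ‖x - ∑ j, w j • a j‖ ^ 2 +
      ∑ j, w j * ‖∑ k, w k • a k - a j‖ ^ 2 := by
  set b := ∑ j, w j • a j with hb
  have h1 : ∀ j, w j * ‖x - a j‖ ^ 2 = w j * ‖x - b‖ ^ 2 +
      2 * inner ℝ (x - b) (w j • (b - a j)) + w j * ‖b - a j‖ ^ 2 := by
    intro j
    rw [← sub_add_sub_cancel x b (a j), norm_add_sq_real, inner_smul_right]
    ring
  have h2 : ∑ j, w j • (b - a j) = 0 := by
    simp_rw [smul_sub, Finset.sum_sub_distrib, ← Finset.sum_smul, hw, one_smul, ← hb, sub_self]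
  simp_rw [h1, Finset.sum_add_distrib, ← Finset.mul_sum, ← Finset.sum_mul, hw, ← inner_sum, h2]
  simp

/-- The weighted barycentre is the measure whose quantile function is the weighted mean of the
given quantile functions. -/
theorem isBarycentre_iff {V : Type*} [Fintype V] {w : V → ℝ} (hw : ∀ j, 0 ≤ w j)
    (hw1 : ∑ j, w j = 1) (m : V → U2) (η : U2) :
    IsBarycentre w m η ↔ ∀ x ∈ Ioo (0 : ℝ) 1, invCdf η x = ∑ j, w j * invCdf (m j) x := by
  obtain ⟨β, hβ⟩ := exists_invCdf_eq_sum hw m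
  have key : ∀ ξ : U2, ∑ j, w j * ell2 ξ (m j) ^ 2 =
      ‖quantile ξ - quantile β‖ ^ 2 + ∑ j, w j * ‖quantile β - quantile (m j)‖ ^ 2 := by
    intro ξ
    simp_rw [ell2_eq_norm_quantile_sub]
    rw [sum_mul_norm_sub_sq hw1, ← quantile_eq_sum hβ]
  have hη : IsBarycentre w m η ↔ η = β := by
    constructor
    · intro h
      have h0 := h β
      rw [key, key, sub_self, norm_zero, zero_pow two_ne_zero, add_le_add_iff_right] at h0
      exact quantile_injective <| sub_eq_zero.1 <| norm_eq_zero.1 <|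
        pow_eq_zero_iff two_ne_zero |>.1 (le_antisymm h0 (sq_nonneg _))
    · rintro rfl ξ
      rw [key, key, sub_self, norm_zero, zero_pow two_ne_zero, add_le_add_iff_right]
      positivity
  rw [hη]
  refine ⟨fun h => h ▸ hβ, fun h => quantile_injective ?_⟩
  rw [quantile_eq_sum h, quantile_eq_sum hβ]

theorem existsUnique_isBarycentre {V : Type*} [Fintype V] {w : V → ℝ} (hw : ∀ j, 0 ≤ w j)
    (hw1 : ∑ j, w j = 1) (m : V → U2) : ∃! η : U2, IsBarycentre w m η := by
  simp_rw [isBarycentre_iff hw hw1]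
  obtain ⟨β, hβ⟩ := exists_invCdf_eq_sum hw m
  refine ⟨β, hβ, fun η hη => quantile_injective ?_⟩
  rw [quantile_eq_sum hη, quantile_eq_sum hβ]

end

/-! ### Powers of weighted adjacency matrices -/

section

open Matrix

theorem Matrix.mem_spectrum_iff_exists_mulVec {V : Type*} [Fintype V] [DecidableEq V]
    {A : Matrix V V ℂ} {z : ℂ} : z ∈ spectrum ℂ A ↔ ∃ v ≠ 0, A *ᵥ v = z • v := by
  rw [← Matrix.spectrum_toLin', ← Module.End.hasEigenvalue_iff_mem_spectrum]
  constructor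
  · intro h
    obtain ⟨v, hv⟩ := h.exists_hasEigenvector
    exact ⟨v, hv.2, by simpa using hv.apply_eq_smul⟩
  · rintro ⟨v, hv, h⟩
    exact Module.End.hasEigenvalue_of_hasEigenvector
      ⟨Module.End.mem_eigenspace_iff.2 (by simpa using h), hv⟩

theorem Matrix.map_ofReal_pow {V : Type*} [Fintype V] [DecidableEq V] (A : Matrix V V ℝ) (t : ℕ) :
    A.map Complex.ofReal ^ t = (A ^ t).map Complex.ofReal :=
  (map_pow Complex.ofRealHom.mapMatrix A t).symm

/-- The entries of the powers of a complex matrix grow at most like the powers of any number that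
exceeds all eigenvalue moduli. -/
theorem Matrix.pow_apply_isBigO {V : Type*} [Fintype V] [DecidableEq V] (A : Matrix V V ℂ)
    {r ρ : ℝ} (hr : 0 ≤ r) (hA : ∀ z ∈ spectrum ℂ A, ‖z‖ ≤ r) (hρ : r < ρ) (i j : V) :
    (fun t : ℕ => (A ^ t) i j) =O[atTop] fun t => ρ ^ t := by
  let : NormedRing (Matrix V V ℂ) := Matrix.linftyOpNormedRing
  let : NormedAlgebra ℂ (Matrix V V ℂ) := Matrix.linftyOpNormedAlgebra
  have hρ0 : 0 < ρ := hr.trans_lt hρ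
  have hrad : spectralRadius ℂ A < ENNReal.ofReal ρ := by
    refine lt_of_le_of_lt (iSup₂_le fun z hz => ?_) ((ENNReal.ofReal_lt_ofReal_iff hρ0).2 hρ)
    rw [← enorm_eq_nnnorm, ← ofReal_norm]
    exact ENNReal.ofReal_le_ofReal (hA z hz)
  refine Asymptotics.IsBigO.of_bound 1 ?_
  filter_upwards [(spectrum.pow_norm_pow_one_div_tendsto_nhds_spectralRadius A).eventually
    (gt_mem_nhds hrad), eventually_ge_atTop 1] with t ht ht1
  have h1 : ‖A ^ t‖ ^ (1 / t : ℝ) ≤ ρ := ((ENNReal.ofReal_lt_ofReal_iff hρ0).1 ht).le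
  have h2 : ‖A ^ t‖ ≤ ρ ^ t := by
    have := pow_le_pow_left₀ (by positivity) h1 t
    rwa [← Real.rpow_natCast, ← Real.rpow_mul (norm_nonneg _), one_div_mul_cancel (by positivity),
      Real.rpow_one] at this
  have h3 : ‖(A ^ t) i j‖ ≤ ‖A ^ t‖ := by
    rw [Matrix.linfty_opNorm_def, ← coe_nnnorm, NNReal.coe_le_coe]
    exact (Finset.single_le_sum (f := fun j => ‖(A ^ t) i j‖₊) (fun _ _ => zero_le)
      (Finset.mem_univ j)).trans
      (Finset.le_sup (f := fun i => ∑ j, ‖(A ^ t) i j‖₊) (Finset.mem_univ i))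
  rw [one_mul, Real.norm_of_nonneg (by positivity)]
  exact h3.trans h2

namespace IsWeightMatrix

variable {V : Type*} [Fintype V] {G : SimpleGraph V} {W : Matrix V V ℝ}

theorem nonneg (hW : IsWeightMatrix G W) (i j : V) : 0 ≤ W i j := by
  by_cases h : i = j ∨ G.Adj i j
  · exact ((hW.pos_iff i j).2 h).le
  · exact (hW.eq_zero i j h).ge

theorem mulVec_const (hW : IsWeightMatrix G W) (c : ℝ) : (W *ᵥ fun _ => c) = fun _ => c := by
  ext i
  simp [Matrix.mulVec, dotProduct, ← Finset.sum_mul, hW.row_sum]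

/-- The maximum principle: subharmonic functions on a connected graph are constant. -/
theorem eq_of_le_mulVec (hW : IsWeightMatrix G W) (hG : G.Connected) {v : V → ℝ}
    (hv : ∀ i, v i ≤ (W *ᵥ v) i) (i j : V) : v i = v j := by
  have := hG.nonempty
  obtain ⟨k, hk⟩ := Finite.exists_max v
  -- the set where the maximum is attained is closed under adjacency
  have step : ∀ a b, v a = v k → G.Adj a b → v b = v k := by
    intro a b ha hab
    have h0 : ∑ j, W a j * (v k - v j) ≤ 0 := by
      have := hv a
      simp only [Matrix.mulVec, dotProduct] at this
      simp only [mul_sub, Finset.sum_sub_distrib, ← Finset.sum_mul, hW.row_sum]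
      linarith
    have hnn : ∀ j ∈ Finset.univ, 0 ≤ W a j * (v k - v j) := fun j _ =>
      mul_nonneg (hW.nonneg a j) (sub_nonneg.2 (hk j))
    have hz := (Finset.sum_eq_zero_iff_of_nonneg hnn).1 (le_antisymm h0 (Finset.sum_nonneg hnn))
      b (Finset.mem_univ b)
    have := (mul_eq_zero.1 hz).resolve_left ((hW.pos_iff a b).2 (Or.inr hab)).ne'
    linarith
  have hall : ∀ a, v a = v k := by
    intro a
    obtain ⟨p⟩ := hG.preconnected k a
    suffices h : ∀ (x y : V), G.Walk x y → v x = v k → v y = v k from h k a p rfl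
    intro x y q
    induction q with
    | nil => exact id
    | cons hadj _ ih => exact fun hx => ih (step _ _ hx hadj)
  rw [hall i, hall j]

/-- `W - 1` maps no vector to a nonzero constant, and only constants to `0`. -/
theorem eq_of_mulVec_eq_add_const (hW : IsWeightMatrix G W) (hG : G.Connected) {v : V → ℝ}
    {c : ℝ} (hv : ∀ i, (W *ᵥ v) i = v i + c) : c = 0 ∧ ∀ i j, v i = v j := by
  have hconst : ∀ i j, v i = v j := by
    rcases le_total 0 c with hc | hc
    · exact hW.eq_of_le_mulVec hG fun i => by rw [hv i]; linarith
    · have := hW.eq_of_le_mulVec hG (v := -v) fun i => by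
        rw [Matrix.mulVec_neg, Pi.neg_apply, Pi.neg_apply, hv i]; linarith
      exact fun i j => neg_injective (this i j)
  refine ⟨?_, hconst⟩
  have := hG.nonempty
  obtain ⟨i⟩ := this
  have hvi : v = fun _ => v i := funext fun j => hconst j i
  have h := hv i
  rw [hvi, hW.mulVec_const] at h
  linarith

theorem eq_of_map_mulVec_eq_add_const (hW : IsWeightMatrix G W) (hG : G.Connected) {v : V → ℂ}
    {c : ℂ} (hv : ∀ i, (W.map Complex.ofReal *ᵥ v) i = v i + c) : c = 0 ∧ ∀ i j, v i = v j := by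
  have hre := hW.eq_of_mulVec_eq_add_const hG (v := fun i => (v i).re) (c := c.re) fun i => by
    have := congrArg Complex.re (hv i)
    simpa [Matrix.mulVec, dotProduct] using this
  have him := hW.eq_of_mulVec_eq_add_const hG (v := fun i => (v i).im) (c := c.im) fun i => by
    have := congrArg Complex.im (hv i)
    simpa [Matrix.mulVec, dotProduct] using this
  exact ⟨Complex.ext hre.1 him.1, fun i j => Complex.ext (hre.2 i j) (him.2 i j)⟩

variable [DecidableEq V]

/-- The Gershgorin discs have centre `W i i > 0` and radius `1 - W i i`: they meet the unit circle
only at `1`. -/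
theorem norm_lt_one_or_eq_one (hW : IsWeightMatrix G W) {z : ℂ}
    (hz : z ∈ spectrum ℂ (W.map Complex.ofReal)) : ‖z‖ < 1 ∨ z = 1 := by
  rw [← Matrix.spectrum_toLin', ← Module.End.hasEigenvalue_iff_mem_spectrum] at hz
  obtain ⟨k, hk⟩ := eigenvalue_mem_ball hz
  have hsum : ∑ j ∈ Finset.univ.erase k, ‖(W.map Complex.ofReal) k j‖ = 1 - W k k := by
    simp only [Matrix.map_apply, Complex.norm_real, Real.norm_of_nonneg (hW.nonneg k _)]
    rw [Finset.sum_erase_eq_sub (Finset.mem_univ k), hW.row_sum]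
  have hpos : 0 < W k k := (hW.pos_iff k k).2 (Or.inl rfl)
  rw [hsum, mem_closedBall_iff_norm, Matrix.map_apply] at hk
  have hsq : ‖z - W k k‖ ^ 2 ≤ (1 - W k k) ^ 2 := pow_le_pow_left₀ (norm_nonneg _) hk 2
  rw [or_iff_not_imp_left, not_lt]
  intro h1
  have h1sq : 1 ≤ ‖z‖ ^ 2 := one_le_pow₀ h1
  have hle : ‖z‖ ≤ 1 := by
    have h := norm_add_le (z - W k k) (W k k : ℂ)
    rw [sub_add_cancel, Complex.norm_real, Real.norm_of_nonneg hpos.le] at h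
    linarith
  have hle2 : ‖z‖ ^ 2 ≤ 1 := pow_le_one₀ (norm_nonneg _) hle
  rw [Complex.sq_norm, Complex.normSq_apply] at hsq h1sq hle2
  simp only [Complex.sub_re, Complex.sub_im, Complex.ofReal_re, Complex.ofReal_im] at hsq
  have hre : 1 ≤ z.re := by
    by_contra! h
    nlinarith
  have hre1 : z.re = 1 := by nlinarith [sq_nonneg z.im]
  have him : z.im = 0 := by nlinarith [sq_nonneg z.im]
  exact Complex.ext hre1 him

/-- `1` is an algebraically simple eigenvalue of `W`. -/
theorem count_roots_charpoly_one_le (hW : IsWeightMatrix G W) (hG : G.Connected) :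
    (W.map Complex.ofReal).charpoly.roots.count 1 ≤ 1 := by
  set f := Matrix.toLin' (W.map Complex.ofReal) with hf
  rw [Polynomial.count_roots, ← Matrix.charpoly_toLin', ← hf,
    ← LinearMap.finrank_maxGenEigenspace_eq]
  have hker : ∀ k : ℕ, ∀ v : V → ℂ, ((f - algebraMap ℂ _ 1) ^ k) v = 0 → ∀ i j, v i = v j := by
    intro k
    induction k with
    | zero =>
      intro v hv i j
      have : v = 0 := hv
      simp [this]
    | succ k ih =>
      intro v hv i j
      rw [pow_succ, Module.End.mul_apply] at hv
      have h := ih _ hv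
      refine (hW.eq_of_map_mulVec_eq_add_const hG (c := (f - algebraMap ℂ _ 1) v i)
        fun l => ?_).2 i j
      rw [h i l]
      simp [hf]
  have hsub : Module.End.maxGenEigenspace f 1 ≤ Submodule.span ℂ {fun _ => (1 : ℂ)} := by
    intro v hv
    obtain ⟨k, hk⟩ := (Module.End.mem_maxGenEigenspace _ _ _).1 hv
    obtain ⟨i⟩ := hG.nonempty
    refine Submodule.mem_span_singleton.2 ⟨v i, ?_⟩
    ext j
    simpa using hker k v (by simpa [Algebra.algebraMap_eq_smul_one] using hk) i j
  refine (Submodule.finrank_mono hsub).trans ?_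
  simpa using finrank_span_le_card (R := ℂ) {fun _ : V => (1 : ℂ)}

theorem slem_lt_one (hW : IsWeightMatrix G W) (hG : G.Connected) : slem W < 1 := by
  rw [slem, ← NNReal.coe_one, NNReal.coe_lt_coe]
  have hlt : ∀ z ∈ (W.map Complex.ofReal).charpoly.roots.erase 1, ‖z‖₊ < 1 := by
    intro z hz
    have hz' := Polynomial.isRoot_of_mem_roots (Multiset.mem_of_mem_erase hz)
    rw [← Matrix.mem_spectrum_iff_isRoot_charpoly] at hz'
    refine (hW.norm_lt_one_or_eq_one hz').resolve_right ?_
    rintro rfl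
    have h1 := Multiset.count_pos.2 hz
    have h2 := hW.count_roots_charpoly_one_le hG
    rw [Multiset.count_erase_self] at h1
    omega
  revert hlt
  induction (W.map Complex.ofReal).charpoly.roots.erase 1 using Multiset.induction with
  | empty => intro _; simp
  | cons a s ih =>
    intro h
    rw [Multiset.map_cons, Multiset.sup_cons, sup_lt_iff]
    exact ⟨h a (Multiset.mem_cons_self a s), ih fun z hz => h z (Multiset.mem_cons_of_mem hz)⟩

end IsWeightMatrix

theorem slem_nonneg {V : Type*} [Fintype V] [DecidableEq V] (W : Matrix V V ℝ) : 0 ≤ slem W :=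
  NNReal.coe_nonneg _

theorem norm_le_slem {V : Type*} [Fintype V] [DecidableEq V] {W : Matrix V V ℝ} {z : ℂ}
    (hz : z ∈ spectrum ℂ (W.map Complex.ofReal)) (h1 : z ≠ 1) : ‖z‖ ≤ slem W := by
  rw [slem, ← coe_nnnorm, NNReal.coe_le_coe]
  refine Multiset.le_sup (Multiset.mem_map_of_mem _ ((Multiset.mem_erase_of_ne h1).2 ?_))
  exact (Polynomial.mem_roots (Matrix.charpoly_monic _).ne_zero).2
    (Matrix.mem_spectrum_iff_isRoot_charpoly.1 hz)

namespace IsWeightMatrix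

variable {V : Type*} [Fintype V] [DecidableEq V] {G : SimpleGraph V} {W : Matrix V V ℝ}

/-- A left eigenvector for the eigenvalue `1`, normalised to total mass `1`. It exists because the
constant vectors are not in the range of `W - 1`, and so are separated from it by a functional. -/
theorem exists_left_eigenvector (hW : IsWeightMatrix G W) (hG : G.Connected) :
    ∃ p : V → ℝ, ∑ i, p i = 1 ∧ p ᵥ* W = p := by
  have h1 : (fun _ => 1 : V → ℝ) ∉ LinearMap.range (Matrix.toLin' (W - 1)) := by
    rintro ⟨v, hv⟩
    refine one_ne_zero (hW.eq_of_mulVec_eq_add_const hG (v := v) (c := (1 : ℝ)) fun i => ?_).1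
    have := congrFun hv i
    simp only [Matrix.toLin'_apply, Matrix.sub_mulVec, Matrix.one_mulVec, Pi.sub_apply] at this
    linarith
  obtain ⟨f, hf1, hf⟩ := Submodule.exists_le_ker_of_notMem h1
  have hsum : ∀ v : V → ℝ, f v = ∑ i, v i * f (Pi.single i 1) := by
    intro v
    conv_lhs => rw [pi_eq_sum_univ' v]
    simp [map_sum]
  refine ⟨fun i => f (Pi.single i 1) / f fun _ => 1, ?_, ?_⟩
  · rw [← Finset.sum_div, div_eq_one_iff_eq hf1, hsum fun _ => 1]
    simp
  · ext j
    have h0 : f ((W - 1) *ᵥ Pi.single j 1) = 0 :=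
      hf ⟨Pi.single j 1, Matrix.toLin'_apply _ _⟩
    rw [Matrix.sub_mulVec, Matrix.one_mulVec, map_sub, sub_eq_zero, hsum] at h0
    simp only [Matrix.mulVec_single_one, Matrix.col_apply] at h0
    simp only [Matrix.vecMul, dotProduct]
    rw [← h0, Finset.sum_div]
    exact Finset.sum_congr rfl fun i _ => by ring

/-- The powers of `W` converge to a matrix with equal rows, faster than `ρ ^ t` for every `ρ`
exceeding the second largest eigenvalue modulus. Subtracting that limit from `W` (deflation)
removes the eigenvalue `1` and introduces no eigenvalue but `0`. -/
theorem exists_pow_apply_sub_isBigO (hW : IsWeightMatrix G W) (hG : G.Connected) :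
    ∃ p : V → ℝ, ∀ ρ, slem W < ρ → ∀ i j,
      (fun t : ℕ => (W ^ t) i j - p j) =O[atTop] fun t => ρ ^ t := by
  obtain ⟨p, hp1, hp⟩ := hW.exists_left_eigenvector hG
  refine ⟨p, fun ρ hρ i j => ?_⟩
  set L : Matrix V V ℝ := Matrix.of fun _ j => p j with hL
  have hWL : W * L = L := by
    ext i j
    simp [hL, Matrix.mul_apply, ← Finset.sum_mul, hW.row_sum]
  have hLW : L * W = L := by
    ext i j
    simpa [hL, Matrix.mul_apply, Matrix.vecMul, dotProduct] using congrFun hp j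
  have hLL : L * L = L := by
    ext i j
    simp [hL, Matrix.mul_apply, ← Finset.sum_mul, hp1]
  have hWtL : ∀ t : ℕ, W ^ t * L = L := by
    intro t
    induction t with
    | zero => simp
    | succ t ih => rw [pow_succ, mul_assoc, hWL, ih]
  have hpow : ∀ t : ℕ, (W - L) ^ (t + 1) = W ^ (t + 1) - L := by
    intro t
    induction t with
    | zero => simp
    | succ t ih =>
      rw [pow_succ, ih, sub_mul, mul_sub, mul_sub, hWtL, hLW, hLL, sub_self, sub_zero, ← pow_succ]
  have hspec : ∀ z ∈ spectrum ℂ ((W - L).map Complex.ofReal), ‖z‖ ≤ slem W := by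
    intro z hz
    rcases eq_or_ne z 0 with rfl | hz0
    · simpa using slem_nonneg W
    obtain ⟨v, hv0, hv⟩ := Matrix.mem_spectrum_iff_exists_mulVec.1 hz
    have hmap : (W - L).map Complex.ofReal =
        W.map Complex.ofReal - L.map Complex.ofReal := by ext; simp
    have hLN : L.map Complex.ofReal * (W - L).map Complex.ofReal = 0 := by
      have h : L * (W - L) = 0 := by rw [mul_sub, hLW, hLL, sub_self]
      exact (map_mul Complex.ofRealHom.mapMatrix L (W - L)).symm.trans (by rw [h, map_zero])
    -- an eigenvector for a nonzero eigenvalue is annihilated by `L`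
    have hLv : L.map Complex.ofReal *ᵥ v = 0 := by
      have h := congrArg (fun u => L.map Complex.ofReal *ᵥ u) hv
      simp only [Matrix.mulVec_mulVec, hLN, Matrix.zero_mulVec, Matrix.mulVec_smul] at h
      exact (smul_eq_zero.1 h.symm).resolve_left hz0
    have hWv : W.map Complex.ofReal *ᵥ v = z • v := by
      rwa [hmap, Matrix.sub_mulVec, hLv, sub_zero] at hv
    refine norm_le_slem (Matrix.mem_spectrum_iff_exists_mulVec.2 ⟨v, hv0, hWv⟩) ?_
    rintro rfl
    have hconst := (hW.eq_of_map_mulVec_eq_add_const hG (v := v) (c := 0) fun i => by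
      rw [hWv]; simp).2
    apply hv0
    ext k
    have h := congrFun hLv k
    have hp1' : ∑ j, (p j : ℂ) = 1 := by exact_mod_cast hp1
    simp only [Matrix.mulVec, dotProduct, Matrix.map_apply, hL, Matrix.of_apply] at h
    simp_rw [fun j => hconst j k, ← Finset.sum_mul, hp1', one_mul] at h
    exact h
  refine Asymptotics.IsBigO.trans (Asymptotics.IsBigO.of_bound 1 ?_)
    (Matrix.pow_apply_isBigO _ (slem_nonneg W) hspec hρ i j)
  -- the two sides differ at `t = 0`, where the deflated power is `1` instead of `1 - L`
  filter_upwards [eventually_ge_atTop 1] with t ht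
  obtain ⟨s, rfl⟩ := Nat.exists_eq_add_of_le' ht
  rw [Matrix.map_ofReal_pow, hpow, one_mul, Matrix.map_apply, Complex.norm_real]
  rfl

theorem tendsto_pow_apply (hW : IsWeightMatrix G W) (hG : G.Connected) {p : V → ℝ}
    (hp : ∀ ρ, slem W < ρ → ∀ i j, (fun t : ℕ => (W ^ t) i j - p j) =O[atTop] fun t => ρ ^ t)
    (i j : V) : Tendsto (fun t : ℕ => (W ^ t) i j) atTop (𝓝 (p j)) := by
  obtain ⟨ρ, h1, h2⟩ := exists_between (hW.slem_lt_one hG)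
  exact tendsto_sub_nhds_zero_iff.1 ((hp ρ h1 i j).trans_tendsto
    (tendsto_pow_atTop_nhds_zero_of_lt_one ((slem_nonneg W).trans h1.le) h2))

theorem pow_nonneg (hW : IsWeightMatrix G W) (t : ℕ) (i j : V) : 0 ≤ (W ^ t) i j := by
  induction t generalizing j with
  | zero =>
    rw [pow_zero, Matrix.one_apply]
    split_ifs <;> norm_num
  | succ t ih =>
    rw [pow_succ, Matrix.mul_apply]
    exact Finset.sum_nonneg fun k _ => mul_nonneg (ih k) (hW.nonneg k j)

/-- In an eigenbasis, `W ^ t` is the sum of a constant term, contributed by the eigenvalue `1`, and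
of terms of size `O(slem W ^ t)`. The constant term is identified as the limit. -/
theorem exists_abs_pow_apply_sub_le (hW : IsWeightMatrix G W) (hG : G.Connected)
    (hd : IsDiagonalisable W) {i j : V} {l : ℝ}
    (hl : Tendsto (fun t : ℕ => (W ^ t) i j) atTop (𝓝 l)) :
    ∃ C : ℝ, ∀ t : ℕ, |(W ^ t) i j - l| ≤ C * slem W ^ t := by
  obtain ⟨P, d, hP, hPd⟩ := hd
  have hspec : ∀ k, d k ∈ spectrum ℂ (W.map Complex.ofReal) := by
    intro k
    refine Matrix.mem_spectrum_iff_exists_mulVec.2 ⟨P *ᵥ Pi.single k 1, fun h0 => ?_, ?_⟩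
    · have h := congrArg (fun v => P⁻¹ *ᵥ v) h0
      simp only [Matrix.mulVec_mulVec, Matrix.nonsing_inv_mul P hP, Matrix.one_mulVec,
        Matrix.mulVec_zero] at h
      simpa using congrFun h k
    · rw [Matrix.mulVec_mulVec, hPd, ← Matrix.mulVec_mulVec, ← Matrix.mulVec_smul]
      congr 1
      ext m
      simp [Pi.single_apply]
  have hpow : ∀ t : ℕ, W.map Complex.ofReal ^ t * P = P * Matrix.diagonal d ^ t := by
    intro t
    induction t with
    | zero => simp
    | succ t ih => rw [pow_succ, mul_assoc, hPd, ← mul_assoc, ih, mul_assoc, ← pow_succ]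
  have hentry : ∀ t : ℕ, (((W ^ t) i j : ℝ) : ℂ) = ∑ k, P i k * d k ^ t * P⁻¹ k j := by
    intro t
    have h : (W ^ t).map Complex.ofReal = P * Matrix.diagonal d ^ t * P⁻¹ := by
      rw [← hpow, mul_assoc, Matrix.mul_nonsing_inv P hP, mul_one, Matrix.map_ofReal_pow]
    rw [← Matrix.map_apply (f := Complex.ofReal), h, Matrix.diagonal_pow, Matrix.mul_apply]
    simp [Matrix.mul_diagonal]
  set c : ℂ := ∑ k, if d k = 1 then P i k * P⁻¹ k j else 0 with hc
  set C : ℝ := ∑ k, ‖P i k‖ * ‖P⁻¹ k j‖ with hC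
  have hbound : ∀ t : ℕ, ‖(((W ^ t) i j : ℝ) : ℂ) - c‖ ≤ C * slem W ^ t := by
    intro t
    rw [hentry, hc, hC, ← Finset.sum_sub_distrib, Finset.sum_mul]
    refine (norm_sum_le _ _).trans (Finset.sum_le_sum fun k _ => ?_)
    have hs := slem_nonneg W
    split_ifs with h
    · rw [h, one_pow, mul_one, sub_self, norm_zero]
      positivity
    · rw [sub_zero, norm_mul, norm_mul, norm_pow, mul_right_comm]
      exact mul_le_mul_of_nonneg_left
        (pow_le_pow_left₀ (norm_nonneg _) (norm_le_slem (hspec k) h) t) (by positivity)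
  have hcl : c = (l : ℂ) := by
    refine tendsto_nhds_unique (f := fun t : ℕ => (((W ^ t) i j : ℝ) : ℂ)) (l := atTop) ?_
      ((Complex.continuous_ofReal.tendsto l).comp hl)
    refine tendsto_sub_nhds_zero_iff.1 (squeeze_zero_norm hbound ?_)
    simpa using (tendsto_pow_atTop_nhds_zero_of_lt_one (slem_nonneg W)
      (hW.slem_lt_one hG)).const_mul C
  refine ⟨C, fun t => ?_⟩
  have h := hbound t
  rwa [hcl, ← Complex.ofReal_sub, Complex.norm_real, Real.norm_eq_abs] at h

end IsWeightMatrix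

end

/-! ### Convergence of trajectories -/

theorem IsTrajectory.invCdf_succ {V : Type*} [Fintype V] {G : SimpleGraph V} {W : Matrix V V ℝ}
    (hW : IsWeightMatrix G W) {μ : ℕ → V → U2} (hμ : IsTrajectory W μ) (t : ℕ) (i : V) :
    ∀ x ∈ Set.Ioo (0 : ℝ) 1, invCdf (μ (t + 1) i) x = ∑ j, W i j * invCdf (μ t j) x :=
  (isBarycentre_iff (hW.nonneg i) (hW.row_sum i) _ _).1 (hμ t i)

theorem IsTrajectory.quantile_eq {V : Type*} [Fintype V] [DecidableEq V] {G : SimpleGraph V}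
    {W : Matrix V V ℝ} (hW : IsWeightMatrix G W) {μ : ℕ → V → U2} (hμ : IsTrajectory W μ)
    (t : ℕ) (i : V) : quantile (μ t i) = ∑ j, (W ^ t) i j • quantile (μ 0 j) := by
  induction t generalizing i with
  | zero => simp [Matrix.one_apply]
  | succ t ih =>
    rw [quantile_eq_sum (hμ.invCdf_succ hW t i)]
    simp_rw [ih, Finset.smul_sum, smul_smul, pow_succ', Matrix.mul_apply, Finset.sum_smul]
    exact Finset.sum_comm

/-- A rate of convergence for the entries of the powers of `W` is a rate of convergence for the
trajectory in the Wasserstein metric. -/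
theorem IsTrajectory.exists_ell2_le {V : Type*} [Fintype V] [DecidableEq V] {G : SimpleGraph V}
    {W : Matrix V V ℝ} (hW : IsWeightMatrix G W) {μ : ℕ → V → U2} (hμ : IsTrajectory W μ)
    {p : V → ℝ} {μstar : U2} (hstar : quantile μstar = ∑ j, p j • quantile (μ 0 j)) {r : ℕ → ℝ}
    (hr : ∀ i j, ∃ C : ℝ, ∀ t : ℕ, |(W ^ t) i j - p j| ≤ C * r t) :
    ∃ C : ℝ, ∀ t i, ell2 (μ t i) μstar ≤ C * r t := by
  choose C hC using hr
  have hC0 : ∀ i j t, 0 ≤ C i j * r t := fun i j t => (abs_nonneg _).trans (hC i j t)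
  refine ⟨∑ i, ∑ j, C i j * ‖quantile (μ 0 j)‖, fun t i => ?_⟩
  rw [ell2_eq_norm_quantile_sub, hμ.quantile_eq hW, hstar, ← Finset.sum_sub_distrib]
  calc ‖∑ j, ((W ^ t) i j • quantile (μ 0 j) - p j • quantile (μ 0 j))‖
      ≤ ∑ j, C i j * r t * ‖quantile (μ 0 j)‖ := by
        refine norm_sum_le_of_le _ fun j _ => ?_
        rw [← sub_smul, norm_smul, Real.norm_eq_abs]
        exact mul_le_mul_of_nonneg_right (hC i j t) (norm_nonneg _)
    _ ≤ ∑ i, ∑ j, C i j * r t * ‖quantile (μ 0 j)‖ :=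
        Finset.single_le_sum (f := fun i => ∑ j, C i j * r t * ‖quantile (μ 0 j)‖)
          (fun k _ => Finset.sum_nonneg fun j _ => mul_nonneg (hC0 k j t) (norm_nonneg _))
          (Finset.mem_univ i)
    _ = (∑ i, ∑ j, C i j * ‖quantile (μ 0 j)‖) * r t := by
        simp_rw [Finset.sum_mul, mul_right_comm]

theorem proposition3 {V : Type*} [Fintype V] [DecidableEq V]
    (G : SimpleGraph V) (hG : G.Connected)
    (W : Matrix V V ℝ) (hW : IsWeightMatrix G W) :
    -- the update is well defined
    (∀ (m : V → U2) (i : V), ∃! η : U2, IsBarycentre (W i) m η) ∧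
    -- the second largest eigenvalue modulus is smaller than one
    slem W < 1 ∧
    ∀ μ : ℕ → V → U2, IsTrajectory W μ →
      -- the update is linear on inverse cumulative distribution functions
      (∀ t i, ∀ x ∈ Set.Ioo (0 : ℝ) 1,
        invCdf (μ (t + 1) i) x = ∑ j, W i j * invCdf (μ t j) x) ∧
      -- consensus, at an exponential rate governed by the second largest eigenvalue modulus
      ∃ μstar : U2,
        (∀ i, Tendsto (fun t => ell2 (μ t i) μstar) atTop (𝓝 0)) ∧
        (∀ ρ : ℝ, slem W < ρ → ∃ C : ℝ, ∀ t i, ell2 (μ t i) μstar ≤ C * ρ ^ t) ∧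
        (IsDiagonalisable W → ∃ C : ℝ, ∀ t i, ell2 (μ t i) μstar ≤ C * slem W ^ t) := by
  refine ⟨fun m i => existsUnique_isBarycentre (hW.nonneg i) (hW.row_sum i) m,
    hW.slem_lt_one hG, fun μ hμ => ⟨hμ.invCdf_succ hW, ?_⟩⟩
  obtain ⟨p, hp⟩ := hW.exists_pow_apply_sub_isBigO hG
  have hlim := hW.tendsto_pow_apply hG hp
  obtain ⟨i₀⟩ := hG.nonempty
  have hp0 : ∀ j, 0 ≤ p j := fun j =>
    ge_of_tendsto' (hlim i₀ j) fun t => hW.pow_nonneg t i₀ j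
  obtain ⟨μstar, hstar⟩ := exists_invCdf_eq_sum hp0 (μ 0)
  have hrate : ∀ ρ : ℝ, slem W < ρ → ∃ C : ℝ, ∀ t i, ell2 (μ t i) μstar ≤ C * ρ ^ t := by
    intro ρ hρ
    have hρ0 : 0 < ρ := (slem_nonneg W).trans_lt hρ
    refine hμ.exists_ell2_le hW (quantile_eq_sum hstar) fun i j => ?_
    obtain ⟨C, -, hC⟩ := Asymptotics.bound_of_isBigO_nat_atTop (hp ρ hρ i j)
    refine ⟨C, fun t => ?_⟩
    have h := hC (pow_ne_zero t hρ0.ne')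
    rwa [Real.norm_eq_abs, Real.norm_of_nonneg (pow_pos hρ0 t).le] at h
  refine ⟨μstar, fun i => ?_, hrate, fun hd => hμ.exists_ell2_le hW (quantile_eq_sum hstar)
    fun i j => hW.exists_abs_pow_apply_sub_le hG hd (hlim i j)⟩
  obtain ⟨ρ, h1, h2⟩ := exists_between (hW.slem_lt_one hG)
  obtain ⟨C, hC⟩ := hrate ρ h1
  refine squeeze_zero (fun t => Real.sqrt_nonneg _) (fun t => hC t i) ?_
  simpa using (tendsto_pow_atTop_nhds_zero_of_lt_one
    ((slem_nonneg W).trans h1.le) h2).const_mul C
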